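/- Let $\Sigma$ be a finite alphabet. A 1-state generalized finite automaton (GFA) $\mathcal G$ over $\Sigma$ is given by a real transition number $A_a$ for each $a\in\Sigma$ and real numbers $v_0$ (initial) and $f$ (final); its accepting value on a word $w=w_1\cdots w_k$ is $f_{\mathcal G}(w)=f\,A_{w_k}\cdots A_{w_1}v_0$. For $\lambda\in\mathbb R$ put $L(\mathcal G,\lambda)=\{w\in\Sigma^*\mid f_{\mathcal G}(w)>\lambda\}$; the languages of this form are the 1-state pseudo stochastic languages, and $\mathcal G$ (with cutpoint $\lambda$) is said to generate $L(\mathcal G,\lambda)$. Fix any logarithm base greater than 1, and consider the numbers $\log|A_a|$ for all $a\in\Sigma$ with $A_a\neq 0$. They have the same sign if they are all $\ge 0$ or all $\le 0$; they are rationally equivalent if there exist $\gamma\in\mathbb R$ and $q_a\in\mathbb Q$ with $\log|A_a|=q_a\gamma$ for all these $a$. **Theorem.** 1. A 1-state pseudo stochastic language is regular if and only if it is generated by some 1-state GFA for which the logarithms of the absolute values of all nonzero transition numbers have the same sign. Moreover, if a 1-state GFA $\mathcal G$ and a cutpoint $\lambda$ satisfy $f\ne0$, $v_0\neq 0$, $\lambda\ne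 0$, and either $\lambda/(fv_0)>0$ or at least one transition number of $\mathcal G$ is negative, then $L(\mathcal G,\lambda)$ is regular if and only if the logarithms of the absolute values of all nonzero transition numbers of $\mathcal G$ have the same sign. 2. If $\mathcal G$ is any 1-state GFA and $\lambda$ any cutpoint such that $L(\mathcal G,\lambda)$ is not regular, then $L(\mathcal G,\lambda)$ is context-free if and only if the logarithms of the absolute values of all nonzero transition numbers of $\mathcal G$ are rationally equivalent. -/

import Mathlib

open scoped Matrix

/-- A generalized finite automaton (GFA) with the states `0, …, n - 1` over the alphabet `α`:
a real transition matrix for every letter, an initial column vector and a final row vector. -/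
structure GFA (n : ℕ) (α : Type*) where
  /-- The transition matrix of a letter. -/
  A : α → Matrix (Fin n) (Fin n) ℝ
  /-- The initial vector. -/
  v₀ : Fin n → ℝ
  /-- The final vector. -/
  f : Fin n → ℝ

namespace GFA

/-- The state vector reached after reading the word `w` from left to right: each letter `a` that
is read replaces the current column vector `v` by `A a * v`. -/
def stateAfter {n : ℕ} {α : Type*} (G : GFA n α) (w : List α) : Fin n → ℝ :=
  w.foldl (fun v a => G.A a *ᵥ v) G.v₀

/-- The accepting value `f * A_{w_k} * ⋯ * A_{w_1} * v₀` of a GFA on the word `w_1 ⋯ w_k`. -/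
def acceptingValue {n : ℕ} {α : Type*} (G : GFA n α) (w : List α) : ℝ :=
  G.f ⬝ᵥ G.stateAfter w

/-- The language recognized by a GFA with cutpoint `c`. -/
def cutpointLanguage {n : ℕ} {α : Type*} (G : GFA n α) (c : ℝ) : Language α :=
  {w : List α | c < G.acceptingValue w}

/-- The transition number of a letter in a 1-state GFA. -/
def transitionNumber {α : Type*} (G : GFA 1 α) (a : α) : ℝ := G.A a 0 0

/-- The logarithms (to base `B`) of the absolute values of all nonzero transition numbers have the
same sign: none is negative, or none is positive (zero logarithms are compatible with both). -/
def LogsSameSign {α : Type*} (G : GFA 1 α) (B : ℝ) : Prop :=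
  (∀ a, G.transitionNumber a ≠ 0 → 0 ≤ Real.logb B |G.transitionNumber a|) ∨
  (∀ a, G.transitionNumber a ≠ 0 → Real.logb B |G.transitionNumber a| ≤ 0)

/-- The logarithms (to base `B`) of the absolute values of all nonzero transition numbers are
rationally equivalent: they are rational multiples of one real number. -/
def LogsRationallyEquivalent {α : Type*} (G : GFA 1 α) (B : ℝ) : Prop :=
  ∃ (γ : ℝ) (q : α → ℚ), ∀ a, G.transitionNumber a ≠ 0 →
    Real.logb B |G.transitionNumber a| = (q a : ℝ) * γ

end GFA

/-- An `n`-state pseudo stochastic language: one recognized by some `n`-state GFA with some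
real cutpoint. -/
def IsPseudoStochastic {α : Type*} (n : ℕ) (L : Language α) : Prop :=
  ∃ (G : GFA n α) (c : ℝ), L = G.cutpointLanguage c

/-! With one state everything commutes: the accepting value of a word is `κ` times the product of
its transition numbers, with `κ` the product of the initial and final numbers. Up to signs,
membership compares a sum of logarithms with a threshold.

If the logarithms have one sign, then beyond some bound the size of a prefix product no longer
matters, at most its sign, and only finitely many products are within the bound. So there are
finitely many left quotients (`isRegular_productCut`). If both signs occur and the cutpoint is not
degenerate, powers of an expanding letter are separated by powers of a contracting one
(`not_isRegular_productCut`). Degenerate cutpoints only see signs, or nothing at all.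

For rationally equivalent logarithms the sum is an integer weight, and the sign lives in a finite
monoid. A word meeting a bounded lower bound on its weight can be cut into two words meeting bounded
lower bounds with the same sum, so finitely many nonterminals suffice
(`isContextFree_setOf_isUpperSet`). Otherwise a positive and a negative logarithm have irrational
ratio. By density, some accepted word is closer to the threshold than any change that a short pumped
pair can cause; pumping up or down then crosses the threshold (`not_isContextFree_productCut`). The
colors in the pumping lemma `exists_pump` keep the sign fixed and protect a letter that may be
needed to make the threshold positive. -/

namespace Language

/-! ### Splitting families and grammars -/

variable {α ι : Type*}

/-- A family of languages is *splitting* if every word of length at least two in a member is the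
concatenation of nonempty words from two members whose product is contained in that member. -/
def IsSplittingFamily (F : ι → Language α) : Prop :=
  ∀ i, ∀ w ∈ F i, 2 ≤ w.length → ∃ j k u v, w = u ++ v ∧ u ≠ [] ∧ v ≠ [] ∧
    u ∈ F j ∧ v ∈ F k ∧ F j * F k ≤ F i

/-- The rules of a grammar that are sound for a family of languages. -/
inductive SoundRule (F : ι → Language α) : ContextFreeRule α ι → Prop
  | nil (i) (h : [] ∈ F i) : SoundRule F ⟨i, []⟩
  | single (i a) (h : [a] ∈ F i) : SoundRule F ⟨i, [Symbol.terminal a]⟩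
  | mul (i j k) (h : F j * F k ≤ F i) :
      SoundRule F ⟨i, [Symbol.nonterminal j, Symbol.nonterminal k]⟩

/-- The language of a symbol, with respect to languages assigned to the nonterminals. -/
def ofSymbol (F : ι → Language α) : Symbol α ι → Language α
  | .terminal a => {[a]}
  | .nonterminal i => F i

/-- The language of a sentential form. -/
def ofForm (F : ι → Language α) (s : List (Symbol α ι)) : Language α :=
  (s.map (ofSymbol F)).prod

lemma ofForm_append (F : ι → Language α) (s t : List (Symbol α ι)) :
    ofForm F (s ++ t) = ofForm F s * ofForm F t := by
  simp [ofForm]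

lemma mem_ofForm_map_terminal (F : ι → Language α) (w : List α) :
    w ∈ ofForm F (w.map Symbol.terminal) := by
  induction w with
  | nil => simp [ofForm, Language.mem_one]
  | cons a w ih =>
    have : a :: w = [a] ++ w := rfl
    rw [this, List.map_append, ofForm_append]
    exact Language.append_mem_mul (by simp [ofForm, ofSymbol]; rfl) ih

lemma SoundRule.ofForm_le {F : ι → Language α} {r : ContextFreeRule α ι} (h : SoundRule F r) :
    ofForm F r.output ≤ F r.input := by
  cases h with
  | nil i h =>
    intro w hw
    obtain rfl : w = [] := hw
    exact h
  | single i a h =>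
    intro w hw
    have e : ofForm F [Symbol.terminal a] = {[a]} := by simp [ofForm, ofSymbol]
    obtain rfl : w = [a] := e.le hw
    exact h
  | mul i j k h => simpa [ofForm, ofSymbol] using h

lemma finite_soundRule [Finite α] [Finite ι] (F : ι → Language α) :
    {r | SoundRule F r}.Finite := by
  refine Set.Finite.subset (((Set.finite_range fun i : ι => (⟨i, []⟩ : ContextFreeRule α ι)).union
    (Set.finite_range fun p : ι × α => ⟨p.1, [Symbol.terminal p.2]⟩)).union
    (Set.finite_range fun p : ι × ι × ι =>
      ⟨p.1, [Symbol.nonterminal p.2.1, Symbol.nonterminal p.2.2]⟩)) ?_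
  rintro _ (⟨i, _⟩ | ⟨i, a, _⟩ | ⟨i, j, k, _⟩)
  · exact Or.inl (Or.inl ⟨i, rfl⟩)
  · exact Or.inl (Or.inr ⟨(i, a), rfl⟩)
  · exact Or.inr ⟨(i, j, k), rfl⟩

/-- The members of a finite splitting family over a finite alphabet are context-free. -/
theorem IsSplittingFamily.isContextFree {ι : Type} [Finite α] [Finite ι] {F : ι → Language α}
    (hF : IsSplittingFamily F) (i : ι) : (F i).IsContextFree := by
  let g : ContextFreeGrammar α := ⟨ι, i, (finite_soundRule F).toFinset⟩
  have hg (r : ContextFreeRule α ι) : r ∈ g.rules ↔ SoundRule F r := by simp [g]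
  refine ⟨g, le_antisymm ?_ ?_⟩
  · have key : ∀ s t, g.Derives s t → ofForm F t ≤ ofForm F s := by
      intro s t h
      induction h with
      | refl => exact le_rfl
      | tail _ h ih =>
        refine le_trans ?_ ih
        obtain ⟨r, hr, h⟩ := h
        obtain ⟨p, q, rfl, rfl⟩ := h.exists_parts
        rw [ofForm_append, ofForm_append, ofForm_append, ofForm_append]
        refine mul_le_mul_left (mul_le_mul_right ?_ _) _
        simpa [ofForm, ofSymbol] using ((hg r).1 hr).ofForm_le
    intro w hw
    have := key _ _ hw (mem_ofForm_map_terminal F w)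
    simpa [ofForm, ofSymbol] using this
  -- Both factors of a splitting are nonempty, hence strictly shorter than the word.
  · have key : ∀ n, ∀ w : List α, w.length = n → ∀ j, w ∈ F j →
        g.Derives [Symbol.nonterminal j] (w.map Symbol.terminal) := by
      intro n
      induction n using Nat.strong_induction_on with
      | _ n ih =>
      intro w hn j hw
      have step (s) (hs : SoundRule F ⟨j, s⟩) : g.Derives [Symbol.nonterminal j] s :=
        ContextFreeGrammar.Produces.single ⟨⟨j, s⟩, (hg _).2 hs,
          ContextFreeRule.Rewrites.input_output (r := ⟨j, s⟩)⟩
      match w, hn, hw with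
      | [], _, hw => exact step _ (.nil _ hw)
      | [a], _, hw => exact step _ (.single _ _ hw)
      | a :: b :: w, hn, hw =>
        obtain ⟨k, l, u, v, e, hu, hv, huk, hvl, hle⟩ := hF j _ hw (by simp)
        have hl : u.length + v.length = n := by rw [← hn, e, List.length_append]
        have hu' := List.length_pos_iff.2 hu
        have hv' := List.length_pos_iff.2 hv
        rw [e, List.map_append]
        refine (step _ (.mul j k l hle)).trans ?_
        exact ((ih _ (by omega) u rfl k huk).append_right [Symbol.nonterminal l]).trans
          ((ih _ (by omega) v rfl l hvl).append_left _)
    exact fun w hw => key _ w rfl i hw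

end Language

/-! ### Parse trees of context-free grammars -/

namespace ContextFreeGrammar

variable {α : Type*} {g : ContextFreeGrammar α}

/-- The words derivable from a sentential form, described by parse trees. -/
inductive Yields (g : ContextFreeGrammar α) : List (Symbol α g.NT) → List α → Prop
  | nil : Yields g [] []
  | terminal (a s w) (h : Yields g s w) : Yields g (Symbol.terminal a :: s) (a :: w)
  | nonterminal (r s u v) (hr : r ∈ g.rules) (hu : Yields g r.output u) (hv : Yields g s v) :
      Yields g (Symbol.nonterminal r.input :: s) (u ++ v)

lemma Yields.append {s t : List (Symbol α g.NT)} {u v : List α} (hu : g.Yields s u)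
    (hv : g.Yields t v) : g.Yields (s ++ t) (u ++ v) := by
  induction hu with
  | nil => exact hv
  | terminal a s w _ ih => exact .terminal _ _ _ ih
  | nonterminal r s u v hr hu _ _ ih =>
    rw [List.append_assoc]
    exact .nonterminal _ _ _ _ hr hu ih

lemma Yields.exists_append {t : List (Symbol α g.NT)} :
    ∀ {s : List (Symbol α g.NT)} {w : List α}, g.Yields (s ++ t) w →
      ∃ u v, w = u ++ v ∧ g.Yields s u ∧ g.Yields t v
  | [], w, h => ⟨[], w, rfl, .nil, h⟩
  | x :: s, w, h => by
    rw [List.cons_append] at h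
    cases h with
    | terminal a _ w h =>
      obtain ⟨u, v, rfl, hu, hv⟩ := h.exists_append
      exact ⟨a :: u, v, rfl, .terminal _ _ _ hu, hv⟩
    | nonterminal r _ u v hr hu hv =>
      obtain ⟨u', v', rfl, hu', hv'⟩ := hv.exists_append
      exact ⟨u ++ u', v', by simp, .nonterminal _ _ _ _ hr hu hu', hv'⟩

lemma Yields.of_rewrites {r : ContextFreeRule α g.NT} (hr : r ∈ g.rules)
    {s t : List (Symbol α g.NT)} (h : r.Rewrites s t) {w : List α} (hw : g.Yields t w) :
    g.Yields s w := by
  induction h generalizing w with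
  | head s =>
    obtain ⟨u, v, rfl, hu, hv⟩ := hw.exists_append
    exact .nonterminal _ _ _ _ hr hu hv
  | cons x _ ih =>
    cases hw with
    | terminal a _ w h => exact .terminal _ _ _ (ih h)
    | nonterminal r _ u v hr hu hv => exact .nonterminal _ _ _ _ hr hu (ih hv)

lemma yields_map_terminal (w : List α) : g.Yields (w.map Symbol.terminal) w := by
  induction w with
  | nil => exact .nil
  | cons a w ih => exact .terminal _ _ _ ih

lemma Yields.derives {s : List (Symbol α g.NT)} {w : List α} (h : g.Yields s w) :
    g.Derives s (w.map Symbol.terminal) := by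
  induction h with
  | nil => exact Derives.refl _
  | terminal a s w _ ih => exact ih.append_left [Symbol.terminal a]
  | nonterminal r s u v hr _ _ ihu ihv =>
    rw [List.map_append]
    have h1 : g.Derives [Symbol.nonterminal r.input] r.output :=
      Produces.single ⟨r, hr, ContextFreeRule.Rewrites.input_output⟩
    exact ((h1.trans ihu).append_right s).trans (ihv.append_left _)

lemma derives_iff_yields {s : List (Symbol α g.NT)} {w : List α} :
    g.Derives s (w.map Symbol.terminal) ↔ g.Yields s w := by
  refine ⟨fun h => ?_, Yields.derives⟩
  induction h using Relation.ReflTransGen.head_induction_on with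
  | refl => exact yields_map_terminal w
  | head h _ ih =>
    obtain ⟨r, hr, h⟩ := h
    exact ih.of_rewrites hr h

/-- The language of a sentential form of a grammar. -/
def formLanguage (g : ContextFreeGrammar α) (s : List (Symbol α g.NT)) : Language α :=
  {w | g.Yields s w}

lemma formLanguage_mul_le (s t : List (Symbol α g.NT)) :
    g.formLanguage s * g.formLanguage t ≤ g.formLanguage (s ++ t) := by
  rintro _ ⟨u, hu, v, hv, rfl⟩
  exact Yields.append hu hv

/-- The subwords of the initial form and of the right-hand sides of the rules. -/
def subforms (g : ContextFreeGrammar α) : Set (List (Symbol α g.NT)) :=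
  {s | s.Sublist [Symbol.nonterminal g.initial] ∨ ∃ r ∈ g.rules, s.Sublist r.output}

lemma finite_subforms : g.subforms.Finite := by
  have h (l : List (Symbol α g.NT)) : {s : List (Symbol α g.NT) | s.Sublist l}.Finite :=
    l.sublists.finite_toSet.subset fun s hs => by simpa using hs
  refine ((h [Symbol.nonterminal g.initial]).union
    (g.rules.finite_toSet.biUnion fun r _ => h r.output)).subset ?_
  rintro s (hs | ⟨r, hr, hs⟩)
  · exact Or.inl hs
  · exact Or.inr (Set.mem_biUnion (by exact hr) hs)

lemma subforms_of_sublist {s t : List (Symbol α g.NT)} (ht : t ∈ g.subforms) (h : s.Sublist t) :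
    s ∈ g.subforms := by
  rcases ht with ht | ⟨r, hr, ht⟩
  · exact Or.inl (h.trans ht)
  · exact Or.inr ⟨r, hr, h.trans ht⟩

/-- A parse tree splits its word after the part produced by the first symbol. If one of the two
parts is empty, descend to the other: any word of the smaller form is also a word of the larger one,
because the empty part can be reused. -/
lemma isSplittingFamily_formLanguage :
    Language.IsSplittingFamily fun s : g.subforms => g.formLanguage s := by
  rintro ⟨s, hs⟩ w (hw : g.Yields s w) h2
  induction hw with
  | nil => simp at h2
  | terminal a s w h ih =>
    refine ⟨⟨[.terminal a], subforms_of_sublist hs (by simp)⟩,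
      ⟨s, subforms_of_sublist hs (by simp)⟩, [a], w, rfl, by simp, ?_, .terminal _ _ _ .nil, h,
      formLanguage_mul_le [_] s⟩
    rintro rfl
    simp at h2
  | nonterminal r s u v hr hu hv ihu ihv =>
    by_cases hu0 : u = []
    · subst hu0
      obtain ⟨j, k, u', v', e, h1, h2, h3, h4, h5⟩ :=
        ihv (subforms_of_sublist hs (by simp)) h2
      refine ⟨j, k, u', v', e, h1, h2, h3, h4, h5.trans fun w hw => ?_⟩
      exact Yields.nonterminal _ _ _ _ hr hu hw
    by_cases hv0 : v = []
    · subst hv0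
      obtain ⟨j, k, u', v', e, h1, h2, h3, h4, h5⟩ :=
        ihu (Or.inr ⟨r, hr, List.Sublist.refl _⟩) (by simpa using h2)
      refine ⟨j, k, u', v', by simpa using e, h1, h2, h3, h4, h5.trans fun w hw => ?_⟩
      have := Yields.nonterminal _ _ _ _ hr hw hv
      rwa [List.append_nil] at this
    · refine ⟨⟨[.nonterminal r.input], subforms_of_sublist hs (by simp)⟩,
        ⟨s, subforms_of_sublist hs (by simp)⟩, u, v, rfl, hu0, hv0, ?_, hv,
        formLanguage_mul_le [_] s⟩
      have := Yields.nonterminal _ _ _ _ hr hu .nil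
      rwa [List.append_nil] at this

end ContextFreeGrammar

/-! ### Pumping with finitely many colors -/

namespace Language

variable {α ι : Type*}

/-- Every context-free language belongs to a finite splitting family. -/
theorem IsContextFree.exists_splittingFamily.{u} {α : Type u} {L : Language α} (hL : L.IsContextFree) :
    ∃ (ι : Type u) (_ : Finite ι) (F : ι → Language α) (i : ι), IsSplittingFamily F ∧ F i = L := by
  obtain ⟨g, rfl⟩ := hL
  refine ⟨g.subforms, g.finite_subforms.to_subtype, _,
    ⟨[.nonterminal g.initial], Or.inl (List.Sublist.refl _)⟩, g.isSplittingFamily_formLanguage, ?_⟩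
  ext w
  exact g.derives_iff_yields.symm

/-- `InContext F i j u z` says that `u` and `z` form a context turning words of `F j` into words
of `F i`. -/
def InContext (F : ι → Language α) (i j : ι) (u z : List α) : Prop :=
  ∀ t ∈ F j, u ++ (t ++ z) ∈ F i

lemma InContext.refl (F : ι → Language α) (i : ι) : InContext F i i [] [] := by
  intro t ht
  simpa using ht

lemma InContext.trans {F : ι → Language α} {i j k : ι} {u u' z z' : List α}
    (h : InContext F i j u z) (h' : InContext F j k u' z') :
    InContext F i k (u ++ u') (z' ++ z) := by
  intro t ht
  simpa using h _ (h' t ht)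

lemma IsSplittingFamily.exists_large_part {F : ι → Language α} (hF : IsSplittingFamily F) {i : ι}
    {w : List α} (hw : w ∈ F i) {n : ℕ} (hn : 1 ≤ n) (hl : 2 * n ≤ w.length) :
    ∃ j u x z, w = u ++ (x ++ z) ∧ x ∈ F j ∧ InContext F i j u z ∧ u ++ z ≠ [] ∧ n ≤ x.length := by
  obtain ⟨j, k, u, v, rfl, hu, hv, huj, hvk, hle⟩ := hF i w hw (by omega)
  rw [List.length_append] at hl
  by_cases h : n ≤ u.length
  · exact ⟨j, [], u, v, rfl, huj, fun t ht => show t ++ v ∈ F i from hle (append_mem_mul ht hvk),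
      by simpa, h⟩
  · refine ⟨k, u, v, [], by simp, hvk, fun t ht => ?_, by simpa, by omega⟩
    rw [List.append_nil]
    exact hle (append_mem_mul huj ht)

/-- Keep passing to a large factor until its length drops below `2 * n`. This localizes the pump, so
that the pumped pair has bounded length. -/
lemma IsSplittingFamily.exists_part {F : ι → Language α} (hF : IsSplittingFamily F) {n : ℕ}
    (hn : 1 ≤ n) {i : ι} {w : List α} (hw : w ∈ F i) (hl : n ≤ w.length) :
    ∃ j u x z, w = u ++ (x ++ z) ∧ x ∈ F j ∧ InContext F i j u z ∧ n ≤ x.length ∧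
      x.length < 2 * n := by
  induction hm : w.length using Nat.strong_induction_on generalizing i w with
  | _ m ih =>
  by_cases h2 : w.length < 2 * n
  · exact ⟨i, [], w, [], by simp, hw, .refl _ _, hl, h2⟩
  obtain ⟨j, u, x, z, rfl, hx, hc, hne, hnx⟩ := hF.exists_large_part hw hn (not_lt.1 h2)
  have := List.length_pos_iff.2 hne
  simp only [List.length_append] at this hm
  obtain ⟨k, u', x', z', rfl, hx', hc', h⟩ := ih x.length (by omega) hx hnx rfl
  exact ⟨k, u ++ u', x', z' ++ z, by simp, hx', hc.trans hc', h⟩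

/-- A word `w` of `F i` contains a nonempty pumpable pair whose removal from its part does not
change the color. -/
def HasPump {C : Type*} (F : ι → Language α) (col : List α → C) (i : ι) (w : List α) : Prop :=
  ∃ j u v x y z, w = u ++ (v ++ (x ++ (y ++ z))) ∧ x ∈ F j ∧ InContext F i j u z ∧
    InContext F j j v y ∧ v ++ y ≠ [] ∧ col (v ++ (x ++ y)) = col x

lemma HasPump.of_inContext {C : Type*} {F : ι → Language α} {col : List α → C} {i j : ι}
    {u x z : List α} (h : HasPump F col j x) (hc : InContext F i j u z) :
    HasPump F col i (u ++ (x ++ z)) := by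
  obtain ⟨k, u', v, x, y, z', rfl, hx, hc', h⟩ := h
  exact ⟨k, u ++ u', v, x, y, z' ++ z, by simp, hx, hc.trans hc', h⟩

/-- Pigeonhole along a chain of nested parts: `V` collects the pairs (member, color) already met,
and each step at worst halves the length. After `n` steps every pair is in `V`, so one repeats, and
two nested parts with the same pair form a pump. -/
lemma IsSplittingFamily.hasPump_or {C : Type*} [Fintype ι] [Fintype C] {F : ι → Language α}
    (hF : IsSplittingFamily F) (col : List α → C) (n : ℕ) (V : Finset (ι × C))
    (hV : Fintype.card (ι × C) ≤ V.card + n) {i : ι} {w : List α} (hw : w ∈ F i)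
    (hl : 2 ^ n ≤ w.length) :
    HasPump F col i w ∨ ∃ j u x z, w = u ++ (x ++ z) ∧ x ∈ F j ∧ InContext F i j u z ∧
      (j, col x) ∈ V := by
  classical
  by_cases hi : (i, col w) ∈ V
  · exact Or.inr ⟨i, [], w, [], by simp, hw, .refl _ _, hi⟩
  induction n generalizing V i w with
  | zero =>
    have : V = Finset.univ := Finset.eq_univ_of_card _ (le_antisymm (Finset.card_le_univ _) hV)
    simp [this] at hi
  | succ n ih =>
    obtain ⟨j, u, x, z, rfl, hx, hc, hne, hnx⟩ :=
      hF.exists_large_part hw Nat.one_le_two_pow (n := 2 ^ n) (by rwa [pow_succ'] at hl)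
    have key : HasPump F col j x ∨ ∃ k u' x' z', x = u' ++ (x' ++ z') ∧ x' ∈ F k ∧
        InContext F j k u' z' ∧ (k, col x') ∈ insert (i, col (u ++ (x ++ z))) V := by
      by_cases hj : (j, col x) ∈ insert (i, col (u ++ (x ++ z))) V
      · exact Or.inr ⟨j, [], x, [], by simp, hx, .refl _ _, hj⟩
      · refine ih _ ?_ hx hnx hj
        rw [Finset.card_insert_of_notMem hi]
        omega
    rcases key with h | ⟨k, u', x', z', rfl, hx', hc', hk⟩
    · exact Or.inl (h.of_inContext hc)
    rcases Finset.mem_insert.1 hk with hk | hk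
    · obtain ⟨rfl, hcol⟩ := Prod.mk.inj hk
      refine Or.inl ⟨k, [], u ++ u', x', z' ++ z, [], by simp, hx', .refl _ _, hc.trans hc', ?_, ?_⟩
      · intro h
        apply hne
        simp only [List.append_eq_nil_iff] at h ⊢
        exact ⟨h.1.1, h.2.2⟩
      · rw [hcol]
        simp
    · exact Or.inr ⟨k, u ++ u', x', z' ++ z, by simp, hx', hc.trans hc', hk⟩

/-- A pumping lemma for context-free languages, in which the part that is pumped can be chosen such
that pumping it down preserves a given coloring of words by finitely many colors. -/
theorem IsContextFree.exists_pump {C : Type*} [Finite C] (col : List α → C) {L : Language α}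
    (hL : L.IsContextFree) : ∃ p : ℕ, ∀ w ∈ L, p ≤ w.length → ∃ u v x y z,
      w = u ++ (v ++ (x ++ (y ++ z))) ∧ v ++ y ≠ [] ∧ (v ++ y).length ≤ p ∧
      col (v ++ (x ++ y)) = col x ∧ u ++ (x ++ z) ∈ L ∧
      u ++ (v ++ (v ++ (x ++ (y ++ (y ++ z))))) ∈ L := by
  obtain ⟨ι, _, F, i, hF, rfl⟩ := hL.exists_splittingFamily
  have := Fintype.ofFinite ι
  have := Fintype.ofFinite C
  refine ⟨2 * 2 ^ Fintype.card (ι × C), fun w hw hl => ?_⟩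
  obtain ⟨j, u, x, z, rfl, hx, hc, h1, h2⟩ :=
    hF.exists_part (n := 2 ^ Fintype.card (ι × C)) Nat.one_le_two_pow hw (by omega)
  obtain ⟨k, u', v, x, y, z', rfl, hx, hc', hvy, hne, hcol⟩ | ⟨_, _, _, _, _, _, _, h⟩ :=
    hF.hasPump_or col _ ∅ (by simp) hx h1
  · refine ⟨u ++ u', v, x, y, z' ++ z, by simp, hne, ?_, hcol, ?_, ?_⟩
    · simp only [List.length_append] at h2 ⊢
      omega
    · exact hc.trans hc' x hx
    · simpa using hc.trans hc' _ (hvy _ (hvy x hx))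
  · simp at h

end Language

/-! ### Context-free languages from integer weights -/

/-- A discrete intermediate value principle: upward steps are at most `M`, so the first value
reaching `c` overshoots by less than `M`. -/
lemma exists_crossing {f : ℕ → ℤ} {M c : ℤ} (hf : ∀ k, f (k + 1) ≤ f k + M) (h1 : f 1 < c) {n : ℕ}
    (hn : 1 ≤ n) (h : c ≤ f n) : ∃ k, 1 ≤ k ∧ k ≤ n ∧ c ≤ f k ∧ f k < c + M := by
  induction n, hn using Nat.le_induction with
  | base => omega
  | succ n hn ih =>
    by_cases hc : c ≤ f n
    · obtain ⟨k, hk⟩ := ih hc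
      exact ⟨k, by omega⟩
    · exact ⟨n + 1, by omega, le_rfl, h, by linarith [hf n]⟩

lemma List.abs_sum_take_succ_sub_le {α : Type*} {h : α → ℤ} {M : ℤ} (hM : ∀ a, |h a| ≤ M)
    (hM0 : 0 ≤ M) (w : List α) (k : ℕ) :
    |((w.take (k + 1)).map h).sum - ((w.take k).map h).sum| ≤ M := by
  rw [List.take_add_one]
  cases hk : w[k]? with
  | none => simpa
  | some a => simpa using hM a

lemma List.exists_weight_split {α : Type*} {h : α → ℤ} {M : ℤ} (hM : ∀ a, |h a| ≤ M)
    (hM0 : 0 ≤ M) {i : ℤ} (hi : |i| ≤ M) {w : List α} (hl : 2 ≤ w.length)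
    (hw : i ≤ (w.map h).sum) :
    ∃ u v j, w = u ++ v ∧ u ≠ [] ∧ v ≠ [] ∧ |j| ≤ M ∧ |i - j| ≤ M ∧ j ≤ (u.map h).sum ∧
      i - j ≤ (v.map h).sum := by
  set f : ℕ → ℤ := fun k => ((w.take k).map h).sum with hf
  have hstep (k) : |f (k + 1) - f k| ≤ M := List.abs_sum_take_succ_sub_le hM hM0 w k
  have hup (k) : f (k + 1) ≤ f k + M := by linarith [(abs_le.1 (hstep k)).2]
  have hdown (k) : f k - M ≤ f (k + 1) := by linarith [(abs_le.1 (hstep k)).1]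
  obtain ⟨n, hn⟩ : ∃ n, w.length = n + 1 := ⟨w.length - 1, by omega⟩
  have hfn : f (n + 1) = (w.map h).sum := by rw [hf, ← hn]; simp
  have hf0 : f 0 = 0 := by simp [hf]
  rw [abs_le] at hi
  -- `c` is the least `j` allowed by `|j| ≤ M` and `|i - j| ≤ M`. It suffices to cut where prefix
  -- and suffix both weigh at least `c`; then `j` is the prefix weight, capped at the largest
  -- allowed value.
  set c := max (-M) (i - M) with hc
  suffices ∃ k, 1 ≤ k ∧ k ≤ n ∧ c ≤ f k ∧ f k ≤ f (n + 1) - c by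
    obtain ⟨k, hk1, hkn, h1, h2⟩ := this
    have hsum : (w.map h).sum = f k + ((w.drop k).map h).sum := by
      rw [hf, ← List.sum_append, ← List.map_append, List.take_append_drop]
    rw [hfn] at h2
    refine ⟨w.take k, w.drop k, min (f k) (min M (i + M)), (List.take_append_drop k w).symm, ?_, ?_,
      ?_, ?_, min_le_left _ _, ?_⟩
    · intro h0
      have := congrArg List.length h0
      rw [List.length_take, List.length_nil] at this
      omega
    · intro h0
      have := congrArg List.length h0
      rw [List.length_drop, List.length_nil] at this
      omega
    · rw [abs_le]; omega
    · rw [abs_le]; omega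
    · omega
  have h01 := hup 0
  have h10 := hdown 0
  have hn1 := hup n
  have hn2 := hdown n
  simp only [zero_add, hf0] at h01 h10
  by_cases h1 : f 1 < c
  · obtain ⟨k, hk1, hkn, h2, h3⟩ := exists_crossing hup h1 (n := n) (by omega) (by omega)
    exact ⟨k, hk1, hkn, h2, by omega⟩
  by_cases h2 : f 1 ≤ f (n + 1) - c
  · exact ⟨1, le_rfl, by omega, by omega, h2⟩
  obtain ⟨k, hk1, hkn, h3, h4⟩ := exists_crossing (f := fun k => - f k) (M := M)
    (c := - (f (n + 1) - c)) (fun k => by linarith [hdown k]) (by omega) (n := n)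
    (by omega) (by omega)
  exact ⟨k, hk1, hkn, by omega, by omega⟩

lemma IsUpperSet.exists_eq_Ici_or {s : Set ℤ} (hs : IsUpperSet s) :
    ∃ t : ℤ, s = ∅ ∨ s = Set.univ ∨ s = Set.Ici t := by
  by_cases h0 : s = ∅
  · exact ⟨0, Or.inl h0⟩
  by_cases hb : BddBelow s
  · obtain ⟨t, ht, hle⟩ := Int.exists_least_of_bdd (P := (· ∈ s)) ⟨hb.choose, fun z hz => hb.choose_spec hz⟩
      (Set.nonempty_iff_ne_empty.2 h0)
    exact ⟨t, Or.inr (Or.inr (Set.Subset.antisymm hle fun x hx => hs hx ht))⟩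
  · refine ⟨0, Or.inr (Or.inl (Set.eq_univ_of_forall fun x => ?_))⟩
    obtain ⟨y, hy, hyx⟩ := not_bddBelow_iff.1 hb x
    exact hs hyx.le hy

namespace Language

/-- The words with given weights form a context-free language, if the conditions on the integer
weight are lower bounds that depend on a weight in a finite monoid. -/
theorem isContextFree_setOf_isUpperSet {α : Type*} {G : Type} [Finite α] [Monoid G] [Finite G]
    (φ : α → G) (h : α → ℤ) (P : G → Set ℤ) (hP : ∀ g, IsUpperSet (P g)) :
    IsContextFree ({w | (w.map h).sum ∈ P (w.map φ).prod} : Language α) := by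
  choose t ht using fun g => (hP g).exists_eq_Ici_or
  obtain ⟨M₁, hM₁⟩ := (Set.finite_range fun a => |h a|).bddAbove
  obtain ⟨M₂, hM₂⟩ := (Set.finite_range fun g => |t g|).bddAbove
  -- `M` bounds the letter weights, as the splitting requires, and the thresholds `t g`, so that
  -- these occur among the finitely many bounds.
  set M := max 0 (max M₁ M₂)
  have hM0 : 0 ≤ M := le_max_left _ _
  have hMh (a) : |h a| ≤ M :=
    (hM₁ ⟨a, rfl⟩).trans ((le_max_left _ _).trans (le_max_right _ _))
  have hMt (g) : |t g| ≤ M :=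
    (hM₂ ⟨g, rfl⟩).trans ((le_max_right _ _).trans (le_max_right _ _))
  let F : Option (G × Option (Set.Icc (-M) M)) → Language α
    | none => {w | (w.map h).sum ∈ P (w.map φ).prod}
    | some (g, none) => {w | (w.map φ).prod = g}
    | some (g, some i) => {w | (w.map φ).prod = g ∧ (i : ℤ) ≤ (w.map h).sum}
  have hfree (g : G) (w) (hw : (w.map φ).prod = g) (hl : 2 ≤ w.length) :
      ∃ j k u v, w = u ++ v ∧ u ≠ [] ∧ v ≠ [] ∧ u ∈ F j ∧ v ∈ F k ∧
        F j * F k ≤ F (some (g, none)) := by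
    match w, hl with
    | a :: b :: w, _ =>
      refine ⟨some (φ a, none), some (((b :: w).map φ).prod, none), [a], b :: w, rfl, by simp,
        by simp, show ([a].map φ).prod = φ a by simp, rfl, ?_⟩
      rintro _ ⟨u, hu, v, hv, rfl⟩
      rw [← hw]
      change ((u ++ v).map φ).prod = _
      rw [List.map_append, List.prod_append, show (u.map φ).prod = _ from hu,
        show (v.map φ).prod = _ from hv, List.map_cons (a := a), List.prod_cons]
  have hbdd (g : G) (i : Set.Icc (-M) M) (w) (hw : w ∈ F (some (g, some i))) (hl : 2 ≤ w.length) :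
      ∃ j k u v, w = u ++ v ∧ u ≠ [] ∧ v ≠ [] ∧ u ∈ F j ∧ v ∈ F k ∧
        F j * F k ≤ F (some (g, some i)) := by
    obtain ⟨hg, hi⟩ := hw
    obtain ⟨u, v, j, rfl, hu, hv, hj, hij, hju, hjv⟩ :=
      List.exists_weight_split hMh hM0 (abs_le.2 i.2) hl hi
    refine ⟨some ((u.map φ).prod, some ⟨j, abs_le.1 hj⟩),
      some ((v.map φ).prod, some ⟨i - j, abs_le.1 hij⟩), u, v, rfl, hu, hv, ⟨rfl, hju⟩,
      ⟨rfl, hjv⟩, ?_⟩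
    rintro _ ⟨u', ⟨hu1, hu2⟩, v', ⟨hv1, hv2⟩, rfl⟩
    refine ⟨?_, ?_⟩
    · rw [← hg]
      simp only [List.map_append, List.prod_append, hu1, hv1]
    · simp only [List.map_append, List.sum_append]
      simp only at hu2 hv2
      linarith
  refine IsSplittingFamily.isContextFree (F := F) ?_ none
  rintro (_ | ⟨g, _ | i⟩) w hw hl
  · change (w.map h).sum ∈ P (w.map φ).prod at hw
    rcases ht (w.map φ).prod with h0 | h0 | h0
    · simp [h0] at hw
    · obtain ⟨j, k, u, v, h1, h2, h3, h4, h5, h6⟩ := hfree _ w rfl hl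
      refine ⟨j, k, u, v, h1, h2, h3, h4, h5, h6.trans fun x hx => ?_⟩
      change (x.map φ).prod = _ at hx
      change (x.map h).sum ∈ P (x.map φ).prod
      rw [hx, h0]
      trivial
    · obtain ⟨j, k, u, v, h1, h2, h3, h4, h5, h6⟩ :=
        hbdd (w.map φ).prod ⟨t (w.map φ).prod, abs_le.1 (hMt _)⟩ w ⟨rfl, by rwa [h0] at hw⟩ hl
      refine ⟨j, k, u, v, h1, h2, h3, h4, h5, h6.trans fun x hx => ?_⟩
      change (x.map h).sum ∈ P (x.map φ).prod
      rw [hx.1, h0]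
      exact hx.2
  · exact hfree g w hw hl
  · exact hbdd g i w hw hl

end Language

/-! ### Regular and nonregular cutpoint languages of products -/

namespace Language

variable {α : Type*}

/-- The words whose weight, a product of real numbers `A a` over the letters scaled by `κ`,
exceeds the bound `c`. -/
def productCut (A : α → ℝ) (κ c : ℝ) : Language α :=
  {w | c < κ * (w.map A).prod}

lemma mem_productCut {A : α → ℝ} {κ c : ℝ} {w : List α} :
    w ∈ productCut A κ c ↔ c < κ * (w.map A).prod := Iff.rfl

lemma mem_leftQuotient_productCut {A : α → ℝ} {κ c : ℝ} {w u : List α} :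
    u ∈ (productCut A κ c).leftQuotient w ↔ c < κ * ((w.map A).prod * (u.map A).prod) := by
  rw [mem_leftQuotient, mem_productCut, List.map_append, List.prod_append]

end Language

lemma List.prod_map_filter_abs_ne_one {α : Type*} (A : α → ℝ) [DecidablePred fun a => |A a| ≠ 1]
    (w : List α) :
    ((w.filter fun a => |A a| ≠ 1).map fun a => |A a|).prod = |(w.map A).prod| := by
  induction w with
  | nil => simp
  | cons a w ih =>
    by_cases h : |A a| = 1
    · simpa [List.filter_cons, h, abs_mul] using ih
    · simpa [List.filter_cons, h, abs_mul] using Or.inl ih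

lemma List.prod_map_le_pow_length {α : Type*} {A : α → ℝ} {r : ℝ} {w : List α}
    (h0 : ∀ a ∈ w, 0 ≤ A a) (h : ∀ a ∈ w, A a ≤ r) : (w.map A).prod ≤ r ^ w.length := by
  induction w with
  | nil => simp
  | cons a w ih =>
    simp only [List.map_cons, List.prod_cons, List.length_cons, pow_succ']
    simp only [List.mem_cons, forall_eq_or_imp] at h0 h
    refine mul_le_mul h.1 (ih h0.2 h.2) (List.prod_nonneg ?_) (h0.1.trans h.1)
    simpa using h0.2

/-- Only finitely many products of a finite set of numbers of absolute value at most one are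
bounded away from zero. -/
lemma finite_setOf_le_abs_prod {α : Type*} [Finite α] {A : α → ℝ} (hA : ∀ a, |A a| ≤ 1) {ε : ℝ}
    (hε : 0 < ε) : {p : ℝ | ε ≤ |p| ∧ ∃ w : List α, p = (w.map A).prod}.Finite := by
  classical
  obtain ⟨r, hr0, hr1, hr⟩ : ∃ r : ℝ, 0 ≤ r ∧ r < 1 ∧ ∀ a, |A a| ≠ 1 → |A a| ≤ r := by
    have := Fintype.ofFinite α
    let s := insert 0 ((Finset.univ.filter fun a => |A a| ≠ 1).image fun a => |A a|)
    have hs : s.Nonempty := ⟨0, by simp [s]⟩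
    refine ⟨s.max' hs, s.le_max' _ (by simp [s]), ?_, fun a ha => s.le_max' _ ?_⟩
    · rw [Finset.max'_lt_iff]
      intro y hy
      rcases Finset.mem_insert.1 hy with rfl | hy
      · exact one_pos
      · obtain ⟨a, ha, rfl⟩ := Finset.mem_image.1 hy
        exact lt_of_le_of_ne (hA a) (Finset.mem_filter.1 ha).2
    · exact Finset.mem_insert_of_mem (Finset.mem_image_of_mem _ (by simpa using ha))
  -- A product of absolute value at least `ε` has at most `N` factors of absolute value other than
  -- one; the remaining factors affect only its sign.
  obtain ⟨N, hN⟩ := exists_pow_lt_of_lt_one hε hr1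
  have hfin : ((fun l : List α => (l.map fun a => |A a|).prod) '' {l | l.length ≤ N}).Finite :=
    (List.finite_length_le α N).image _
  refine (hfin.union (hfin.image Neg.neg)).subset ?_
  rintro _ ⟨hp, w, rfl⟩
  have hmem : |(w.map A).prod| ∈
      (fun l : List α => (l.map fun a => |A a|).prod) '' {l | l.length ≤ N} := by
    refine ⟨w.filter fun a => |A a| ≠ 1, ?_, List.prod_map_filter_abs_ne_one A w⟩
    by_contra hlt
    simp only [Set.mem_ofPred_eq, not_le] at hlt
    have h1 := List.prod_map_le_pow_length (A := fun a => |A a|) (r := r)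
      (w := w.filter fun a => |A a| ≠ 1) (fun a _ => abs_nonneg _)
      (fun a ha => hr a (by simpa using (List.mem_filter.1 ha).2))
    rw [List.prod_map_filter_abs_ne_one] at h1
    have h2 := pow_le_pow_of_le_one hr0 hr1.le hlt.le
    linarith
  rcases abs_choice (w.map A).prod with h | h
  · rw [h] at hmem
    exact Or.inl hmem
  · exact Or.inr ⟨_, hmem, by rw [h, neg_neg]⟩

namespace Language

variable {α : Type*}

lemma isRegular_productCut_zero (A : α → ℝ) (κ : ℝ) : (productCut A κ 0).IsRegular := by
  refine .of_finite_range_leftQuotient <| (Set.finite_range fun s : SignType =>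
    ({u | 0 < κ * (s * (u.map A).prod)} : Language α)).subset ?_
  rintro _ ⟨w, rfl⟩
  refine ⟨SignType.sign (w.map A).prod, ?_⟩
  refine Language.ext fun u => Iff.trans ?_ mem_leftQuotient_productCut.symm
  change 0 < κ * (_ * _) ↔ _
  rcases lt_trichotomy (w.map A).prod 0 with h | h | h
  · rw [sign_neg h, mul_left_comm, mul_left_comm κ (w.map A).prod]
    simp [mul_pos_iff, h, h.not_gt]
  · simp [h]
  · rw [sign_pos h, mul_left_comm, mul_left_comm κ (w.map A).prod]
    simp [mul_pos_iff, h]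

/-- A left quotient depends only on the product of the prefix. Once this is below `|c| / (|κ| + 1)`
in absolute value, no continuation reaches `|c|`, and the product may be replaced by zero. The
summand `1` covers `κ = 0`. -/
lemma isRegular_productCut_of_le_one [Finite α] {A : α → ℝ} (hA : ∀ a, |A a| ≤ 1) (κ : ℝ) {c : ℝ}
    (hc : c ≠ 0) : (productCut A κ c).IsRegular := by
  have hle (u : List α) : |(u.map A).prod| ≤ 1 := by
    rw [← List.prod_map_filter_abs_ne_one]
    simpa using List.prod_map_le_pow_length (A := fun a => |A a|) (r := 1) (fun a _ => abs_nonneg _)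
      (fun a _ => hA a)
  let Q : ℝ → Language α := fun p => {u | c < κ * (p * (u.map A).prod)}
  have hε : 0 < |c| / (|κ| + 1) := by positivity
  refine .of_finite_range_leftQuotient <|
    (((finite_setOf_le_abs_prod hA hε).image Q).union (Set.finite_singleton (Q 0))).subset ?_
  rintro _ ⟨w, rfl⟩
  have hw : (productCut A κ c).leftQuotient w = Q (w.map A).prod := by
    ext u
    exact mem_leftQuotient_productCut
  rw [hw]
  by_cases h : |c| / (|κ| + 1) ≤ |(w.map A).prod|
  · exact Or.inl ⟨_, ⟨h, w, rfl⟩, rfl⟩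
  · refine Or.inr ?_
    rw [Set.mem_singleton_iff]
    ext u
    change c < _ ↔ c < κ * (0 * _)
    rw [not_le, lt_div_iff₀ (by positivity)] at h
    have : |κ * ((w.map A).prod * (u.map A).prod)| < |c| := by
      rw [abs_mul, abs_mul]
      have h1 : |(w.map A).prod| * |(u.map A).prod| ≤ |(w.map A).prod| :=
        mul_le_of_le_one_right (abs_nonneg _) (hle u)
      nlinarith [abs_nonneg κ, abs_nonneg (w.map A).prod, mul_le_mul_of_nonneg_left h1 (abs_nonneg κ)]
    rw [abs_lt] at this
    rw [zero_mul, mul_zero]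
    rcases lt_or_gt_of_ne hc with hc | hc
    · rw [abs_of_neg hc, neg_neg] at this
      exact ⟨fun _ => hc, fun _ => this.1⟩
    · rw [abs_of_pos hc] at this
      exact ⟨fun h => absurd h this.2.not_gt, fun h => absurd h hc.not_gt⟩

/-- Once the prefix product exceeds `|c| / |κ|` in absolute value, every continuation with nonzero
product stays beyond `|c|`, so only the sign of the prefix matters. The finitely many smaller
nonzero products are found by inverting all factors. -/
lemma isRegular_productCut_of_one_le [Finite α] {A : α → ℝ} (hA : ∀ a, A a ≠ 0 → 1 ≤ |A a|)
    {κ c : ℝ} (hκ : κ ≠ 0) (hc : c ≠ 0) : (productCut A κ c).IsRegular := by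
  have hge (u : List α) : (u.map A).prod = 0 ∨ 1 ≤ |(u.map A).prod| := by
    induction u with
    | nil => simp
    | cons a u ih =>
      rw [List.map_cons, List.prod_cons, mul_eq_zero, abs_mul]
      by_cases h0 : A a = 0
      · exact Or.inl (Or.inl h0)
      rcases ih with h | h
      · exact Or.inl (Or.inr h)
      · exact Or.inr (one_le_mul_of_one_le_of_one_le (hA a h0) h)
  let Q : ℝ → Language α := fun p => {u | c < κ * (p * (u.map A).prod)}
  let R : SignType → Language α := fun s =>
    {u | ((u.map A).prod = 0 ∧ c < 0) ∨ 0 < κ * (s * (u.map A).prod)}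
  have hε : 0 < |κ| / |c| := by positivity
  have hinv : ∀ a, |(A a)⁻¹| ≤ 1 := by
    intro a
    by_cases h0 : A a = 0
    · simp [h0]
    · rw [abs_inv]
      exact inv_le_one_of_one_le₀ (hA a h0)
  have hfin := (finite_setOf_le_abs_prod hinv hε).image Inv.inv
  refine .of_finite_range_leftQuotient <|
    ((hfin.image Q).union ((Set.finite_range R).union (Set.finite_singleton (Q 0)))).subset ?_
  rintro _ ⟨w, rfl⟩
  have hw : (productCut A κ c).leftQuotient w = Q (w.map A).prod := by
    ext u
    exact mem_leftQuotient_productCut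
  rw [hw]
  have hprod : (w.map fun a => (A a)⁻¹).prod = ((w.map A).prod)⁻¹ := by
    rw [List.prod_inv, List.map_map]
    rfl
  by_cases h0 : (w.map A).prod = 0
  · rw [h0]
    exact Or.inr (Or.inr rfl)
  by_cases h : |κ| / |c| ≤ |((w.map A).prod)⁻¹|
  · exact Or.inl ⟨_, ⟨_, ⟨h, w, hprod.symm⟩, rfl⟩, by rw [inv_inv]⟩
  refine Or.inr (Or.inl ⟨SignType.sign (w.map A).prod, ?_⟩)
  ext u
  change ((u.map A).prod = 0 ∧ c < 0) ∨ _ ↔ c < _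
  rcases hge u with hu | hu
  · simp [hu]
  have hu0 : (u.map A).prod ≠ 0 := by
    intro h0
    rw [h0, abs_zero] at hu
    linarith
  have hbig : |c| < |κ * ((w.map A).prod * (u.map A).prod)| := by
    rw [abs_inv, not_le, inv_lt_iff_one_lt_mul₀ (by positivity), div_mul_eq_mul_div,
      one_lt_div (by positivity)] at h
    rw [abs_mul, abs_mul, ← mul_assoc]
    exact h.trans_le (le_mul_of_one_le_right (by positivity) hu)
  have hsign : 0 < κ * (SignType.sign (w.map A).prod * (u.map A).prod) ↔
      0 < κ * ((w.map A).prod * (u.map A).prod) := by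
    rcases lt_or_gt_of_ne h0 with h | h
    · rw [sign_neg h, mul_left_comm, mul_left_comm κ (w.map A).prod]
      simp [mul_pos_iff, h, h.not_gt]
    · rw [sign_pos h, mul_left_comm, mul_left_comm κ (w.map A).prod]
      simp [mul_pos_iff, h]
  rw [hsign]
  simp only [hu0, false_and, false_or]
  rw [lt_abs] at hbig
  have hc' := abs_nonneg c
  have h1 := le_abs_self c
  have h2 := neg_abs_le c
  constructor
  · intro h
    rcases hbig with hb | hb <;> linarith
  · intro h
    rcases hbig with hb | hb <;> linarith

/-- A cutpoint language of a product is regular, if no factor has absolute value more than one, or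
no nonzero factor has absolute value less than one. -/
theorem isRegular_productCut [Finite α] {A : α → ℝ} {κ c : ℝ}
    (hA : (∀ a, A a ≠ 0 → 1 ≤ |A a|) ∨ (∀ a, A a ≠ 0 → |A a| ≤ 1)) :
    (productCut A κ c).IsRegular := by
  by_cases hc : c = 0
  · rw [hc]
    exact isRegular_productCut_zero A κ
  by_cases hκ : κ = 0
  · have : productCut A κ c = productCut (fun _ => 1) κ c := by
      ext w
      simp [mem_productCut, hκ]
    rw [this]
    exact isRegular_productCut_of_le_one (by simp) κ hc
  rcases hA with hA | hA
  · exact isRegular_productCut_of_one_le hA hκ hc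
  · refine isRegular_productCut_of_le_one (fun a => ?_) κ hc
    by_cases h : A a = 0
    · simp [h]
    · exact hA a h

lemma lt_mul_iff_of_div_pos {c σ : ℝ} (h : 0 < c / σ) (p : ℝ) :
    c < σ * p ↔ (0 < c ∧ c / σ < p) ∨ (c < 0 ∧ p < c / σ) := by
  rcases div_pos_iff.1 h with ⟨hc, hσ⟩ | ⟨hc, hσ⟩
  · simp [hc, hc.not_gt, div_lt_iff₀' hσ]
  · simp [hc, hc.not_gt, lt_div_iff_of_neg' hσ]

/-- One negative letter repairs a threshold of the wrong sign. Both negative results use such a `z`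
to reduce to a positive threshold. -/
lemma exists_length_le_one_div_pos {A : α → ℝ} {κ c : ℝ} (hκ : κ ≠ 0) (hc : c ≠ 0)
    (h : 0 < c / κ ∨ ∃ a, A a < 0) :
    ∃ z : List α, z.length ≤ 1 ∧ 0 < c / (κ * (z.map A).prod) := by
  by_cases h0 : 0 < c / κ
  · exact ⟨[], by simp, by simpa⟩
  · obtain ⟨d, hd⟩ := h.resolve_left h0
    refine ⟨[d], by simp, ?_⟩
    have : c / κ < 0 := lt_of_le_of_ne (not_lt.1 h0) (div_ne_zero hc hκ)
    simpa [← div_div] using div_pos_of_neg_of_neg this hd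

/-- A nondegenerate cutpoint language of a product is not regular, if there are both factors of
absolute value more than one and nonzero factors of absolute value less than one. -/
theorem not_isRegular_productCut {A : α → ℝ} {κ c : ℝ} (hκ : κ ≠ 0) (hc : c ≠ 0)
    (h : 0 < c / κ ∨ ∃ a, A a < 0) {a b : α} (ha : 1 < |A a|) (hb0 : A b ≠ 0) (hb : |A b| < 1) :
    ¬ (productCut A κ c).IsRegular := by
  obtain ⟨z, -, hz⟩ := exists_length_le_one_div_pos hκ hc h
  intro hreg
  set θ := c / (κ * (z.map A).prod)
  set P := A a ^ 2
  set Q := A b ^ 2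
  have hP : 1 < P := (one_lt_sq_iff_one_lt_abs _).2 ha
  have hQ : Q < 1 := (sq_lt_one_iff_abs_lt_one _).2 hb
  have hQ0 : 0 < Q := by positivity
  -- Infinitely many even powers of `a` share a left quotient. Among them, a suitable suffix `b ^ (2
  -- * n) z` puts a small power below `θ` and a large one above. Even exponents keep the products
  -- positive.
  let f : ℕ → Set.range (productCut A κ c).leftQuotient :=
    fun m => ⟨_, List.replicate (2 * m) a, rfl⟩
  have := hreg.finite_range_leftQuotient.to_subtype
  obtain ⟨y, hy⟩ := Finite.exists_infinite_fiber f
  rw [Set.infinite_coe_iff] at hy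
  have hmem (m n : ℕ) : List.replicate (2 * n) b ++ z ∈ (f m : Language α) ↔
      (0 < c ∧ θ < P ^ m * Q ^ n) ∨ (c < 0 ∧ P ^ m * Q ^ n < θ) := by
    rw [← lt_mul_iff_of_div_pos hz, mem_leftQuotient_productCut]
    simp only [List.map_append, List.map_replicate, List.prod_append, List.prod_replicate, P, Q,
      ← pow_mul]
    ring_nf
  obtain ⟨m₀, hm₀⟩ := hy.nonempty
  obtain ⟨n, hn⟩ := exists_pow_lt_of_lt_one (div_pos hz (pow_pos (one_pos.trans hP) m₀)) hQ
  rw [lt_div_iff₀' (by positivity)] at hn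
  obtain ⟨M, hM⟩ := pow_unbounded_of_one_lt (θ / Q ^ n) hP
  rw [div_lt_iff₀ (by positivity)] at hM
  obtain ⟨m, hm, hmM⟩ := hy.exists_gt M
  have hlarge : θ < P ^ m * Q ^ n :=
    hM.trans_le (mul_le_mul_of_nonneg_right (pow_le_pow_right₀ hP.le hmM.le) (by positivity))
  have heq : f m = f m₀ := hm.trans hm₀.symm
  have := hmem m n
  rw [heq, hmem m₀ n] at this
  rcases lt_or_gt_of_ne hc with hc | hc
  · simp only [hc, hc.not_gt, true_and, false_and, false_or] at this
    exact (this.1 hn).not_gt hlarge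
  · simp only [hc, hc.not_gt, true_and, false_and, or_false] at this
    exact (this.2 hlarge).not_gt hn

end Language

/-! ### Irrational ratios and context-freeness -/

/-- The natural multiples of `x` are dense in the circle of circumference `y`. -/
lemma exists_nat_mul_sub_mul_mem_Ioo {x y : ℝ} (hx : 0 < x) (hy : 0 < y) (h : Irrational (x / y))
    (N : ℕ) {s t : ℝ} (hst : s < t) : ∃ n m : ℕ, N ≤ n ∧ n * x - m * y ∈ Set.Ioo s t := by
  obtain ⟨K, hK⟩ := exists_nat_gt (t / x)
  rw [div_lt_iff₀ hx] at hK
  have := Fact.mk hy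
  have hd : DenseRange (· • (x : AddCircle y) : ℕ → AddCircle y) :=
    denseRange_zsmul_iff_nsmul.1 (AddCircle.denseRange_zsmul_coe_iff.2 h)
  -- Shifting the target by `M * x` moves it below zero, which forces the coefficient of `y` to be
  -- nonnegative; adding `M` back also makes the coefficient of `x` at least `N`.
  set M := max K N
  have hKM : (K : ℝ) ≤ M := by exact_mod_cast le_max_left K N
  have ho : IsOpen ((fun r : ℝ => (r : AddCircle y)) '' Set.Ioo (s - M * x) (t - M * x)) :=
    QuotientAddGroup.isOpenMap_coe _ isOpen_Ioo
  obtain ⟨n, r, hr, hnr⟩ := hd.exists_mem_open ho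
    ((Set.nonempty_Ioo.2 (by linarith)).image _)
  obtain ⟨k, hk⟩ : ∃ k : ℤ, k • y = -r + n • x :=
    AddSubgroup.mem_zmultiples_iff.1 (QuotientAddGroup.eq.1 (by simpa using hnr))
  simp only [zsmul_eq_mul, nsmul_eq_mul, Set.mem_Ioo] at hk hr
  have hMx : (K : ℝ) * x ≤ M * x := mul_le_mul_of_nonneg_right hKM hx.le
  have hnx : 0 ≤ n * x := by positivity
  have hk0 : 0 ≤ k := by
    by_contra! hk0
    have : (k : ℝ) < 0 := by exact_mod_cast hk0
    nlinarith
  lift k to ℕ using hk0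
  refine ⟨n + M, k, (le_max_right K N).trans (Nat.le_add_left _ _), ?_⟩
  push_cast at hk ⊢
  constructor <;> linarith

lemma List.exists_prod_map_eq_pow_mul_pow {α : Type*} (A : α → ℝ) {a b : α} {w : List α}
    (hw : ∀ d ∈ w, d = a ∨ d = b) :
    ∃ i j : ℕ, i + j = w.length ∧ (w.map A).prod = A a ^ i * A b ^ j := by
  induction w with
  | nil => exact ⟨0, 0, by simp⟩
  | cons d w ih =>
    simp only [List.mem_cons, forall_eq_or_imp] at hw
    obtain ⟨i, j, hl, hp⟩ := ih hw.2
    rcases hw.1 with rfl | rfl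
    · exact ⟨i + 1, j, by simp [← hl]; ring, by simp [hp]; ring⟩
    · exact ⟨i, j + 1, by simp [← hl]; ring, by simp [hp]; ring⟩

lemma natCast_mul_add_natCast_mul_ne_zero {x y : ℝ} (h : Irrational (x / y)) {i j : ℕ}
    (hij : i + j ≠ 0) : i * x + j * y ≠ 0 := by
  have hy : y ≠ 0 := by
    rintro rfl
    simp at h
  intro h0
  by_cases hi : i = 0
  · subst hi
    simp [hy] at h0
    omega
  · have hi' : (i : ℝ) ≠ 0 := by exact_mod_cast hi
    refine h ⟨-(j : ℚ) / i, ?_⟩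
    push_cast
    field_simp
    linarith

lemma exists_pos_le_abs_natCast_mul_add {x y : ℝ} (h : Irrational (x / y)) (p : ℕ) :
    ∃ ε : ℝ, 0 < ε ∧ ∀ i j : ℕ, i + j ≠ 0 → i + j ≤ p → ε ≤ |i * x + j * y| := by
  let s := (Finset.range (p + 1) ×ˢ Finset.range (p + 1)).filter fun q : ℕ × ℕ => q.1 + q.2 ≠ 0
  have : ∀ᶠ ε : ℝ in nhdsWithin 0 (Set.Ioi 0), ∀ q ∈ s, ε < |q.1 * x + q.2 * y| := by
    rw [Filter.eventually_all_finset]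
    intro q hq
    exact nhdsWithin_le_nhds (Iio_mem_nhds (abs_pos.2
      (natCast_mul_add_natCast_mul_ne_zero h (Finset.mem_filter.1 hq).2)))
  obtain ⟨ε, hε, hε0⟩ := (this.and self_mem_nhdsWithin).exists
  refine ⟨ε, hε0, fun i j hij hp => (hε (i, j) ?_).le⟩
  simp only [s, Finset.mem_filter, Finset.mem_product, Finset.mem_range]
  omega

namespace Language

variable {α : Type*}

/-- A nondegenerate cutpoint language of a product is not context-free, if there are factors of
absolute values more than one and less than one such that the ratio of their logarithms is
irrational. -/
theorem not_isContextFree_productCut {A : α → ℝ} {κ c : ℝ} (hκ : κ ≠ 0) (hc : c ≠ 0)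
    (h : 0 < c / κ ∨ ∃ a, A a < 0) {a b : α} (ha : 1 < |A a|) (hb0 : A b ≠ 0) (hb : |A b| < 1)
    (hab : Irrational (Real.log |A a| / Real.log |A b|)) :
    ¬ (productCut A κ c).IsContextFree := by
  classical
  obtain ⟨z, hz1, hz⟩ := exists_length_le_one_div_pos hκ hc h
  intro hcf
  let bad : α → Bool := fun d => d ≠ a ∧ d ≠ b
  -- The sign color makes the pumped factor positive. The other color keeps the pumped pair within
  -- the letters `a` and `b`, since the word below has at most one bad letter.
  obtain ⟨p, hp⟩ := hcf.exists_pump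
    fun w : List α => (SignType.sign (w.map A).prod, decide (0 < w.countP bad))
  obtain ⟨ε, hε, hεp⟩ := exists_pos_le_abs_natCast_mul_add hab p
  set θ := c / (κ * (z.map A).prod) with hθ
  have ha0 : A a ≠ 0 := by
    intro h0
    rw [h0, abs_zero] at ha
    linarith
  have hla : 0 < Real.log |A a| := Real.log_pos ha
  have hlb : Real.log |A b| < 0 := Real.log_neg (abs_pos.2 hb0) hb
  have hirr : Irrational ((2 * Real.log |A a|) / (-(2 * Real.log |A b|))) := by
    have : (2 * Real.log |A a|) / (-(2 * Real.log |A b|)) = -(Real.log |A a| / Real.log |A b|) := by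
      field_simp
    rw [this]
    exact hab.neg
  -- The window of width `ε` on the accepting side of `log θ`; the sign of `c` decides which side
  -- that is.
  obtain ⟨s, t, hst, hs⟩ : ∃ s t : ℝ, s < t ∧ ((0 < c ∧ s = Real.log θ ∧ t = Real.log θ + ε) ∨
      (c < 0 ∧ s = Real.log θ - ε ∧ t = Real.log θ)) := by
    rcases lt_or_gt_of_ne hc with hc | hc
    · exact ⟨_, _, by linarith, Or.inr ⟨hc, rfl, rfl⟩⟩
    · exact ⟨_, _, by linarith, Or.inl ⟨hc, rfl, rfl⟩⟩
  obtain ⟨n, m, hn, hnm⟩ := exists_nat_mul_sub_mul_mem_Ioo (by linarith) (by linarith) hirr p hst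
  set P := A a ^ (2 * n) * A b ^ (2 * m) with hP
  have hP0 : 0 < P := by
    rw [hP, pow_mul, pow_mul]
    positivity
  have hlogP : Real.log P = n * (2 * Real.log |A a|) - m * (-(2 * Real.log |A b|)) := by
    rw [← Real.log_abs, hP, abs_mul, abs_pow, abs_pow, Real.log_mul (by positivity) (by positivity),
      Real.log_pow, Real.log_pow]
    push_cast
    ring
  rw [← hlogP] at hnm
  set w := z ++ (List.replicate (2 * n) a ++ List.replicate (2 * m) b) with hw
  have hwprod : (w.map A).prod = (z.map A).prod * P := by
    simp [hw, hP]
  have hcut (r : ℝ) : c < κ * ((z.map A).prod * r) ↔ (0 < c ∧ θ < r) ∨ (c < 0 ∧ r < θ) := by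
    rw [← mul_assoc, lt_mul_iff_of_div_pos hz]
  have hz0 : (z.map A).prod ≠ 0 := by
    intro h0
    rw [hθ, h0, mul_zero, div_zero] at hz
    exact hz.false
  have hcutlog {r : ℝ} (hr : 0 < r) : c < κ * ((z.map A).prod * r) ↔
      (0 < c ∧ Real.log θ < Real.log r) ∨ (c < 0 ∧ Real.log r < Real.log θ) := by
    rw [hcut, Real.log_lt_log_iff hz hr, Real.log_lt_log_iff hr hz]
  have hwmem : w ∈ productCut A κ c := by
    rw [mem_productCut, hwprod, hcutlog hP0]
    rcases hs with ⟨h1, h2, h3⟩ | ⟨h1, h2, h3⟩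
    · exact Or.inl ⟨h1, by linarith [hnm.1]⟩
    · exact Or.inr ⟨h1, by linarith [hnm.2]⟩
  have hwbad : w.countP bad ≤ 1 := by
    have h1 : (List.replicate (2 * n) a).countP bad = 0 := by simp [bad, List.countP_replicate]
    have h2 : (List.replicate (2 * m) b).countP bad = 0 := by simp [bad, List.countP_replicate]
    rw [hw, List.countP_append, List.countP_append, h1, h2]
    exact List.countP_le_length.trans hz1
  obtain ⟨u, v, x, y, z', hdec, hne, hvyp, hcol, hdown, hup⟩ :=
    hp w hwmem (by simp [hw]; omega)
  obtain ⟨hsign, hbad⟩ := Prod.mk.inj hcol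
  rw [hdec] at hwbad hwprod
  rw [mem_productCut] at hdown hup
  simp only [List.map_append, List.prod_append] at hsign hwprod hdown hup
  simp only [List.countP_append] at hbad hwbad
  set δ := (v.map A).prod * (y.map A).prod with hδ
  have hw0 : (z.map A).prod * P ≠ 0 := mul_ne_zero hz0 hP0.ne'
  rw [← hwprod] at hw0
  have hx0 : (x.map A).prod ≠ 0 := by
    intro h0
    simp [h0] at hw0
  have hδ0 : 0 < δ := by
    rw [mul_left_comm, ← hδ, sign_mul] at hsign
    rcases lt_or_gt_of_ne hx0 with hx | hx
    · rw [sign_neg hx] at hsign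
      rcases lt_trichotomy δ 0 with h | h | h
      · rw [sign_neg h] at hsign
        simp at hsign
      · rw [h] at hsign
        simp at hsign
      · exact h
    · rw [sign_pos hx, one_mul] at hsign
      exact sign_eq_one_iff.1 hsign
  have hdown' : c < κ * ((z.map A).prod * (P / δ)) := by
    have : (z.map A).prod * (P / δ) = (u.map A).prod * ((x.map A).prod * (z'.map A).prod) := by
      rw [← mul_div_assoc, ← hwprod, div_eq_iff hδ0.ne', hδ]
      ring
    rwa [this]
  have hup' : c < κ * ((z.map A).prod * (P * δ)) := by
    convert hup using 2
    rw [← mul_assoc, ← hwprod, hδ]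
    ring
  rw [hcutlog (by positivity), Real.log_div hP0.ne' hδ0.ne'] at hdown'
  rw [hcutlog (by positivity), Real.log_mul hP0.ne' hδ0.ne'] at hup'
  have hvyab : ∀ d ∈ v ++ y, d = a ∨ d = b := by
    have h0 : (v ++ y).countP bad = 0 := by
      rw [List.countP_append]
      simp only [decide_eq_decide] at hbad
      omega
    intro d hd
    have := List.countP_eq_zero.1 h0 d hd
    simp only [bad, decide_eq_true_eq] at this
    tauto
  obtain ⟨i, j, hij, hprod⟩ := List.exists_prod_map_eq_pow_mul_pow A hvyab
  rw [List.map_append, List.prod_append, ← hδ] at hprod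
  have hlogδ : Real.log δ = i * Real.log |A a| + j * Real.log |A b| := by
    rw [← Real.log_abs, hprod, abs_mul, abs_pow, abs_pow,
      Real.log_mul (by positivity) (by positivity), Real.log_pow, Real.log_pow]
  have hδε := hεp i j (by rw [hij]; exact (List.length_pos_iff.2 hne).ne') (hij ▸ hvyp)
  -- The pair shifts the logarithm by at least `ε` in one direction, so either adding or removing it
  -- leaves the accepting side.
  rw [← hlogδ, le_abs] at hδε
  obtain ⟨hnm1, hnm2⟩ := hnm
  rcases hs with ⟨h1, h2, h3⟩ | ⟨h1, h2, h3⟩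
  · simp only [h1, h1.not_gt, true_and, false_and, or_false] at hdown' hup'
    rcases hδε with hδε | hδε <;> linarith
  · simp only [h1, h1.not_gt, true_and, false_and, false_or] at hdown' hup'
    rcases hδε with hδε | hδε <;> linarith

/-- A cutpoint language of a product is context-free, if the absolute values of all nonzero factors
are integer powers of one number. -/
theorem isContextFree_productCut [Finite α] {A : α → ℝ} {γ : ℝ} (hγ : 0 < γ) {k : α → ℤ}
    (hk : ∀ a, A a ≠ 0 → Real.log |A a| = k a * γ) (κ c : ℝ) :
    (productCut A κ c).IsContextFree := by
  have hA (a : α) : A a = (SignType.sign (A a) : SignType) * Real.exp (k a * γ) := by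
    by_cases h0 : A a = 0
    · simp [h0]
    · rw [← hk a h0, Real.exp_log (abs_pos.2 h0), sign_mul_abs]
  have hprod (w : List α) : (w.map A).prod =
      ((w.map fun a => SignType.sign (A a)).prod : SignType) *
        Real.exp ((w.map k).sum * γ) := by
    induction w with
    | nil => simp
    | cons a w ih =>
      simp only [List.map_cons, List.prod_cons, List.sum_cons]
      rw [ih]
      conv_lhs => rw [hA a]
      push_cast
      rw [add_mul, Real.exp_add]
      ring
  -- For `0 < c` acceptance forces `κ * s > 0`, so it is monotone in the weight. For `c ≤ 0` it is
  -- antitone instead, or independent of the weight, whence the negated weights.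
  rcases lt_or_ge 0 c with hc | hc
  · have := isContextFree_setOf_isUpperSet (fun a => SignType.sign (A a)) k
      (fun s => {n | c < κ * (s * Real.exp (n * γ))}) ?_
    · refine (congrArg IsContextFree (Language.ext fun w => ?_)).mp this
      refine Iff.symm ?_
      rw [mem_productCut, hprod]
      rfl
    · intro s n n' hn (h : c < κ * (s * Real.exp (n * γ)))
      change c < κ * (s * Real.exp (n' * γ))
      rw [← mul_assoc] at h ⊢
      have hpos : 0 < κ * s := pos_of_mul_pos_left (hc.trans h) (Real.exp_pos _).le
      have : (n : ℝ) ≤ n' := by exact_mod_cast hn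
      refine h.trans_le ?_
      gcongr
  · have := isContextFree_setOf_isUpperSet (fun a => SignType.sign (A a)) (fun a => -k a)
      (fun s => {n | c < κ * (s * Real.exp (-n * γ))}) ?_
    · refine (congrArg IsContextFree (Language.ext fun w => ?_)).mp this
      refine Iff.symm ?_
      rw [mem_productCut, hprod]
      change _ ↔ c < κ * (_ * Real.exp (-((w.map fun a => -k a).sum : ℤ) * γ))
      have : (w.map fun a => -k a).sum = -(w.map k).sum := by
        rw [List.sum_neg, List.map_map]
        rfl
      rw [this]
      simp
    · intro s n n' hn (h : c < κ * (s * Real.exp (-n * γ)))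
      change c < κ * (s * Real.exp (-n' * γ))
      rw [← mul_assoc] at h ⊢
      have : (n : ℝ) ≤ n' := by exact_mod_cast hn
      rcases lt_trichotomy (κ * s) 0 with h0 | h0 | h0
      · refine h.trans_le (mul_le_mul_of_nonpos_left ?_ h0.le)
        gcongr
      · rw [h0, zero_mul] at h ⊢
        exact h
      · exact hc.trans_lt (mul_pos h0 (Real.exp_pos _))

end Language

/-! ### From automata to products -/

namespace GFA

variable {α : Type*}

lemma foldl_mulVec_apply_zero (G : GFA 1 α) (w : List α) (v : Fin 1 → ℝ) :
    w.foldl (fun v a => G.A a *ᵥ v) v 0 = (w.map G.transitionNumber).prod * v 0 := by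
  induction w generalizing v with
  | nil => simp
  | cons a w ih =>
    rw [List.foldl_cons, ih]
    simp [Matrix.mulVec, dotProduct, transitionNumber]
    ring

lemma cutpointLanguage_eq_productCut (G : GFA 1 α) (c : ℝ) :
    G.cutpointLanguage c = Language.productCut G.transitionNumber (G.f 0 * G.v₀ 0) c := by
  refine Language.ext fun w => ?_
  change c < G.f ⬝ᵥ (w.foldl (fun v a => G.A a *ᵥ v) G.v₀) ↔ c < _
  simp only [dotProduct, Fin.sum_univ_one, foldl_mulVec_apply_zero]
  rw [mul_assoc, mul_comm (G.v₀ 0)]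

/-- The 1-state GFA with given transition numbers and a given accepting value of the empty word. -/
def ofNumbers (A : α → ℝ) (κ : ℝ) : GFA 1 α :=
  ⟨fun a _ _ => A a, fun _ => 1, fun _ => κ⟩

lemma cutpointLanguage_ofNumbers (A : α → ℝ) (κ c : ℝ) :
    (ofNumbers A κ).cutpointLanguage c = Language.productCut A κ c := by
  rw [cutpointLanguage_eq_productCut]
  simp only [ofNumbers, mul_one]
  rfl

lemma logsSameSign_iff (G : GFA 1 α) {B : ℝ} (hB : 1 < B) :
    G.LogsSameSign B ↔ (∀ a, G.transitionNumber a ≠ 0 → 1 ≤ |G.transitionNumber a|) ∨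
      (∀ a, G.transitionNumber a ≠ 0 → |G.transitionNumber a| ≤ 1) := by
  refine or_congr (forall₂_congr fun a h => ?_) (forall₂_congr fun a h => ?_)
  · exact Real.logb_nonneg_iff hB (abs_pos.2 h)
  · exact Real.logb_nonpos_iff hB (abs_pos.2 h)

lemma LogsSameSign.isRegular [Finite α] {G : GFA 1 α} {B : ℝ} (hB : 1 < B)
    (h : G.LogsSameSign B) (c : ℝ) : (G.cutpointLanguage c).IsRegular := by
  rw [cutpointLanguage_eq_productCut]
  exact Language.isRegular_productCut ((G.logsSameSign_iff hB).1 h)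

lemma exists_of_not_logsSameSign {G : GFA 1 α} {B : ℝ} (hB : 1 < B) (h : ¬ G.LogsSameSign B) :
    ∃ a b, 1 < |G.transitionNumber a| ∧ G.transitionNumber b ≠ 0 ∧ |G.transitionNumber b| < 1 := by
  rw [logsSameSign_iff G hB] at h
  push Not at h
  obtain ⟨⟨b, hb0, hb⟩, a, -, ha⟩ := h
  exact ⟨a, b, ha, hb0, hb⟩

lemma logsSameSign_of_isRegular {G : GFA 1 α} {B : ℝ} (hB : 1 < B) {c : ℝ}
    (hκ : G.f 0 * G.v₀ 0 ≠ 0) (hc : c ≠ 0)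
    (h : 0 < c / (G.f 0 * G.v₀ 0) ∨ ∃ a, G.transitionNumber a < 0)
    (hreg : (G.cutpointLanguage c).IsRegular) : G.LogsSameSign B := by
  by_contra hs
  obtain ⟨a, b, ha, hb0, hb⟩ := exists_of_not_logsSameSign hB hs
  rw [cutpointLanguage_eq_productCut] at hreg
  exact Language.not_isRegular_productCut hκ hc h ha hb0 hb hreg

/-- A cutpoint language of a degenerate GFA is generated by a GFA whose logarithms are zero. -/
lemma exists_logsSameSign_of_degenerate (G : GFA 1 α) {B : ℝ} (hB : 1 < B) {c : ℝ}
    (h : ¬ (G.f 0 * G.v₀ 0 ≠ 0 ∧ c ≠ 0 ∧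
      (0 < c / (G.f 0 * G.v₀ 0) ∨ ∃ a, G.transitionNumber a < 0))) :
    ∃ G' : GFA 1 α, G.cutpointLanguage c = G'.cutpointLanguage c ∧ G'.LogsSameSign B := by
  set κ := G.f 0 * G.v₀ 0 with hκ
  set A := G.transitionNumber with hA
  by_cases hc : c = 0
  · subst hc
    refine ⟨ofNumbers (fun a => SignType.sign (A a)) κ, ?_, ?_⟩
    · rw [cutpointLanguage_eq_productCut, cutpointLanguage_ofNumbers, ← hκ, ← hA]
      refine Language.ext fun w => ?_
      rw [Language.mem_productCut, Language.mem_productCut]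
      have hw : (w.map fun a => ((SignType.sign (A a) : SignType) : ℝ)).prod =
          (SignType.sign (w.map A).prod : SignType) := by
        induction w with
        | nil => simp
        | cons a w ih => simp [ih, sign_mul]
      rw [hw]
      rcases lt_trichotomy (w.map A).prod 0 with h | h | h
      · simp [sign_neg h, mul_pos_iff, h, h.not_gt]
      · simp [h]
      · simp [sign_pos h, h]
    · rw [logsSameSign_iff _ hB]
      refine Or.inr fun a _ => ?_
      change |((SignType.sign (A a) : SignType) : ℝ)| ≤ 1
      rcases lt_trichotomy (A a) 0 with h | h | h
      · simp [sign_neg h]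
      · simp [h]
      · simp [sign_pos h]
  -- Here `κ = 0`, or `c / κ < 0` and no factor is negative. Either way acceptance of any word just
  -- means `c < 0`.
  refine ⟨ofNumbers (fun _ => 1) 0, ?_, ?_⟩
  · rw [cutpointLanguage_eq_productCut, cutpointLanguage_ofNumbers, ← hκ, ← hA]
    refine Language.ext fun w => ?_
    rw [Language.mem_productCut, Language.mem_productCut, zero_mul]
    by_cases hκ0 : κ = 0
    · rw [hκ0, zero_mul]
    push Not at h
    obtain ⟨hcκ, hpos⟩ := h hκ0 hc
    have hw : 0 ≤ (w.map A).prod := List.prod_nonneg (by simpa using fun a _ => hpos a)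
    have hcκ' := lt_of_le_of_ne hcκ (div_ne_zero hc hκ0)
    rcases div_neg_iff.1 hcκ' with ⟨h1, h2⟩ | ⟨h1, h2⟩
    · have := mul_nonpos_of_nonpos_of_nonneg h2.le hw
      exact ⟨fun h => by linarith, fun h => by linarith⟩
    · have := mul_nonneg h2.le hw
      exact ⟨fun h => by linarith, fun h => by linarith⟩
  · rw [logsSameSign_iff _ hB]
    refine Or.inr fun a _ => ?_
    change |(1 : ℝ)| ≤ 1
    simp

/-- A common denominator of the finitely many rationals and the factor `log B` are absorbed into
`γ`, and a negative sign of `γ` into the integers. -/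
lemma LogsRationallyEquivalent.exists_int [Finite α] {G : GFA 1 α} {B : ℝ} (hB : 1 < B)
    (h : G.LogsRationallyEquivalent B) : ∃ γ : ℝ, 0 < γ ∧ ∃ k : α → ℤ,
      ∀ a, G.transitionNumber a ≠ 0 → Real.log |G.transitionNumber a| = k a * γ := by
  have := Fintype.ofFinite α
  obtain ⟨γ, q, hq⟩ := h
  have hlogB : 0 < Real.log B := Real.log_pos hB
  set D := ∏ b, (q b).den with hD
  have hD0 : (D : ℝ) ≠ 0 := by
    exact_mod_cast Finset.prod_ne_zero_iff.2 fun b _ => (q b).den_ne_zero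
  obtain ⟨k, hk⟩ : ∃ k : α → ℤ, ∀ a, (q a : ℝ) * D = k a := by
    refine ⟨fun a => (q a).num * ((D / (q a).den : ℕ) : ℤ), fun a => ?_⟩
    obtain ⟨e, he⟩ : (q a).den ∣ D := Finset.dvd_prod_of_mem _ (Finset.mem_univ a)
    have hden : ((q a).den : ℝ) ≠ 0 := by exact_mod_cast (q a).den_ne_zero
    beta_reduce
    rw [he, Nat.mul_div_cancel_left _ (q a).den_pos]
    conv_lhs => rw [Rat.cast_def]
    push_cast
    field_simp
  set γ' := γ * Real.log B / D with hγ'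
  have hlog (a) (ha : G.transitionNumber a ≠ 0) :
      Real.log |G.transitionNumber a| = k a * γ' := by
    have h1 := hq a ha
    rw [Real.logb, div_eq_iff hlogB.ne'] at h1
    rw [h1, ← hk, hγ']
    field_simp
  rcases lt_trichotomy γ' 0 with h0 | h0 | h0
  · exact ⟨-γ', by linarith, fun a => -k a, fun a ha => by rw [hlog a ha]; push_cast; ring⟩
  · exact ⟨1, one_pos, fun _ => 0, fun a ha => by rw [hlog a ha, h0]; simp⟩
  · exact ⟨γ', h0, k, hlog⟩

/-- If the logarithms are not rationally equivalent, then the irrationality is witnessed by a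
positive and a negative logarithm, provided that there are both. -/
lemma exists_irrational_of_not_logsRationallyEquivalent {G : GFA 1 α} {B : ℝ} (hB : 1 < B)
    (hs : ¬ G.LogsSameSign B) (h : ¬ G.LogsRationallyEquivalent B) :
    ∃ a b, 1 < |G.transitionNumber a| ∧ G.transitionNumber b ≠ 0 ∧ |G.transitionNumber b| < 1 ∧
      Irrational (Real.log |G.transitionNumber a| / Real.log |G.transitionNumber b|) := by
  obtain ⟨a₀, b₀, ha₀, hb₀, hb₀'⟩ := exists_of_not_logsSameSign hB hs
  by_contra! hrat
  have hla₀ := (Real.log_pos ha₀).ne'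
  have hlb₀ := (Real.log_neg (abs_pos.2 hb₀) hb₀').ne
  have hlogB : Real.log B ≠ 0 := (Real.log_pos hB).ne'
  -- Positive logarithms are compared with that of `b₀` directly, negative ones through the positive
  -- logarithm of `a₀`.
  have key (a) : ∃ q : ℚ, G.transitionNumber a ≠ 0 →
      Real.log |G.transitionNumber a| = q * Real.log |G.transitionNumber b₀| := by
    by_cases ha0 : G.transitionNumber a = 0
    · exact ⟨0, fun h => absurd ha0 h⟩
    rcases lt_trichotomy |G.transitionNumber a| 1 with ha | ha | ha
    · obtain ⟨r, hr⟩ := not_not.1 (hrat a₀ a ha₀ ha0 ha)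
      obtain ⟨r', hr'⟩ := not_not.1 (hrat a₀ b₀ ha₀ hb₀ hb₀')
      have hla := (Real.log_neg (abs_pos.2 ha0) ha).ne
      have hr0 : (r : ℝ) ≠ 0 := by
        rw [hr]
        exact div_ne_zero hla₀ hla
      refine ⟨r' / r, fun _ => ?_⟩
      rw [eq_div_iff hla] at hr
      rw [eq_div_iff hlb₀] at hr'
      push_cast
      rw [div_mul_eq_mul_div, hr', ← hr, mul_div_cancel_left₀ _ hr0]
    · exact ⟨0, fun _ => by rw [ha]; simp⟩
    · obtain ⟨r, hr⟩ := not_not.1 (hrat a b₀ ha hb₀ hb₀')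
      exact ⟨r, fun _ => ((eq_div_iff hlb₀).1 hr).symm⟩
  choose q hq using key
  refine h ⟨Real.logb B |G.transitionNumber b₀|, q, fun a ha => ?_⟩
  rw [Real.logb, Real.logb, hq a ha, mul_div_assoc]

end GFA

theorem mainTheorem6 {α : Type*} [Finite α] (B : ℝ) (hB : 1 < B) :
    -- a 1-state pseudo stochastic language is regular iff it is generated by a GFA with
    -- logarithms of the same sign
    (∀ L : Language α, IsPseudoStochastic 1 L →
      (L.IsRegular ↔
        ∃ (G : GFA 1 α) (c : ℝ), L = G.cutpointLanguage c ∧ G.LogsSameSign B)) ∧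
    -- and then every nondegenerate generating GFA is of that kind
    (∀ (G : GFA 1 α) (c : ℝ), G.f 0 ≠ 0 → G.v₀ 0 ≠ 0 → c ≠ 0 →
      (0 < c / (G.f 0 * G.v₀ 0) ∨ ∃ a, G.transitionNumber a < 0) →
      ((G.cutpointLanguage c).IsRegular ↔ G.LogsSameSign B)) ∧
    -- a nonregular language is context-free iff the logarithms of any generating GFA are
    -- rationally equivalent
    (∀ (G : GFA 1 α) (c : ℝ), ¬ (G.cutpointLanguage c).IsRegular →
      ((G.cutpointLanguage c).IsContextFree ↔ G.LogsRationallyEquivalent B)) := by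
  refine ⟨?_, ?_, ?_⟩
  · rintro _ ⟨G, c, rfl⟩
    refine ⟨fun hreg => ?_, ?_⟩
    · by_cases h : G.f 0 * G.v₀ 0 ≠ 0 ∧ c ≠ 0 ∧
          (0 < c / (G.f 0 * G.v₀ 0) ∨ ∃ a, G.transitionNumber a < 0)
      · exact ⟨G, c, rfl, GFA.logsSameSign_of_isRegular hB h.1 h.2.1 h.2.2 hreg⟩
      · obtain ⟨G', h1, h2⟩ := G.exists_logsSameSign_of_degenerate hB h
        exact ⟨G', c, h1, h2⟩
    · rintro ⟨G', c', h, hs⟩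
      rw [h]
      exact hs.isRegular hB c'
  · intro G c hf hv hc h
    exact ⟨GFA.logsSameSign_of_isRegular hB (mul_ne_zero hf hv) hc h, fun hs => hs.isRegular hB c⟩
  · intro G c hreg
    refine ⟨fun hcf => ?_, fun h => ?_⟩
    · by_contra hrat
      have hs : ¬ G.LogsSameSign B := fun hs => hreg (hs.isRegular hB c)
      obtain ⟨a, b, ha, hb0, hb, hab⟩ :=
        GFA.exists_irrational_of_not_logsRationallyEquivalent hB hs hrat
      -- Nonregularity excludes the degenerate case, since there the language is also generated with
      -- all logarithms zero.
      by_cases h : G.f 0 * G.v₀ 0 ≠ 0 ∧ c ≠ 0 ∧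
          (0 < c / (G.f 0 * G.v₀ 0) ∨ ∃ a, G.transitionNumber a < 0)
      · rw [GFA.cutpointLanguage_eq_productCut] at hcf
        exact Language.not_isContextFree_productCut h.1 h.2.1 h.2.2 ha hb0 hb hab hcf
      · obtain ⟨G', h1, h2⟩ := G.exists_logsSameSign_of_degenerate hB h
        exact hreg (h1 ▸ h2.isRegular hB c)
    · obtain ⟨γ, hγ, k, hk⟩ := h.exists_int hB
      rw [GFA.cutpointLanguage_eq_productCut]
      exact Language.isContextFree_productCut hγ hk _ c
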